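/- For a convex set $K\subseteq\mathbb{R}^n$ let its Gaussian surface area be $$\mathrm{GSA}(K)=\int_{\partial K}\varphi_n(x)\,d\sigma(x),\qquad \varphi_n(x)=(2\pi)^{-n/2}e^{-\|x\|^2/2},$$ where $\partial K$ is the topological boundary of $K$ and $\sigma$ is the surface measure, i.e. the $(n-1)$-dimensional Hausdorff measure on $\mathbb{R}^n$ (normalized to agree with Lebesgue measure on $(n-1)$-dimensional Euclidean space). Let $$\Gamma(n)=\sup\{\mathrm{GSA}(K): K\subseteq\mathbb{R}^n\text{ convex}\}.$$ Then $$\liminf_{n\to\infty}\frac{\Gamma(n)}{n^{1/4}}\ \ge\ e^{-5/4}.$$ -/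

import Mathlib

open MeasureTheory Filter
open scoped ENNReal

noncomputable section

namespace GaussianSurface

/-- The density `φ_n(x) = (2π)^{-n/2} e^{-‖x‖²/2}` of the standard Gaussian measure on `ℝⁿ`. -/
def gaussianDensity (n : ℕ) (x : EuclideanSpace ℝ (Fin n)) : ℝ :=
  (2 * Real.pi) ^ (-(n : ℝ) / 2) * Real.exp (-‖x‖ ^ 2 / 2)

/-- The Gaussian surface area `∫_{∂K} φ_n dσ`, as an extended nonnegative real. The surface
measure `σ` is the `(n-1)`-dimensional Hausdorff measure, normalized so that it is Lebesgue
measure on `(n-1)`-dimensional Euclidean space. Only convex sets `K` in dimension `n ≥ 1` are of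
interest. -/
def gaussianSurfaceArea (n : ℕ) (K : Set (EuclideanSpace ℝ (Fin n))) : ℝ≥0∞ :=
  ∫⁻ x in frontier K, ENNReal.ofReal (gaussianDensity n x) ∂(μHE[n - 1])

/-- `Γ(n)`: the supremum of the Gaussian surface areas of all convex sets in `ℝⁿ`, taken in
`[0, ∞]`. -/
def maxGaussianSurfaceArea (n : ℕ) : ℝ≥0∞ :=
  ⨆ (K : Set (EuclideanSpace ℝ (Fin n))) (_ : Convex ℝ K), gaussianSurfaceArea n K

end GaussianSurface

end

open ProbabilityTheory Topology Set

/-! The lower bound comes from Nazarov's random polytope. With `s = √n`, take about `facetCount s`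
half-spaces `⟪x, G j⟫ ≤ R`, where `R = √(s ^ 3) = n^(3/4)` and the normals are independent standard
Gaussians. The supremum dominates the average surface area, and
`lintegral_facet_le_maxGaussianSurfaceArea` computes a lower bound for that average: the number of
facets, times the mean of a facet's weight times the chance that a Gaussian point of its hyperplane
satisfies all the other constraints.

Write `‖G‖² = s(s + X)`. Since `R²/‖G‖² ≈ s - X`, the weight is about `(2π)^(-1/2) e^(-s/2)
e^(X/2)`. A point `x` of the hyperplane has `‖x‖² ≈ s² + sY + s`, with `Y` the fluctuation of its
parameter, so `R²/‖x‖² ≈ s - 1 - Y` and the Mills bound for violating one constraint is about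
`e^(Y/2) / facetCount s`. All constraints then hold with probability at least about `exp(-e^(Y/2))`.

By the central limit theorem (`tendsto_integral_normFluct`) `X` and `Y` tend to `N(0, 2)`. The mean
of `e^(X/2)` tends to `e^(1/4)`, and the mean of `exp(-e^(Y/2))` has a limit at least `e^(-1)` by
symmetry (`exp_neg_one_le_integral`). The prefactors multiply to `n^(1/4) e^(-1/2)`, which gives
`e^(-1/2 + 1/4 - 1) = e^(-5/4)`. -/

namespace GaussianSurface

local notation "𝔼" n => EuclideanSpace ℝ (Fin n)

/-! ### Gaussian tails and the density of the standard Gaussian -/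

section StdGaussian

/-- The Mills-ratio upper bound for the tail of the standard Gaussian. -/
noncomputable def millsBound (u : ℝ) : ℝ := Real.exp (-u ^ 2 / 2) / (u * √(2 * Real.pi))

/-- On the tail `1 ≤ x / u`, and `x e^(-x²/2)` has an explicit antiderivative. -/
theorem gaussianReal_Ici_le {u : ℝ} (hu : 0 < u) :
    (gaussianReal 0 1).real (Ici u) ≤ millsBound u := by
  have hc : 0 < √(2 * Real.pi) := by positivity
  have hlim : Tendsto (fun x : ℝ => -Real.exp (-x ^ 2 / 2)) atTop (𝓝 (-0)) := by
    refine (Real.tendsto_exp_atBot.comp ?_).neg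
    have : Tendsto (fun x : ℝ => x ^ 2 / 2) atTop atTop :=
      (tendsto_pow_atTop two_ne_zero).atTop_div_const two_pos
    refine (tendsto_neg_atTop_atBot.comp this).congr fun x => ?_
    simp [neg_div]
  have hder : ∀ x ∈ Ici u, HasDerivAt (fun x : ℝ => -Real.exp (-x ^ 2 / 2))
      (x * Real.exp (-x ^ 2 / 2)) x := by
    intro x _
    have h := (((hasDerivAt_pow 2 x).neg.div_const 2).exp).neg
    convert! h using 1
    simp
    ring
  have hnn : ∀ x ∈ Ioi u, 0 ≤ x * Real.exp (-x ^ 2 / 2) := fun x hx => by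
    have : 0 < x := hu.trans hx
    positivity
  have hint := integrableOn_Ioi_deriv_of_nonneg' hder hnn hlim
  have hval := integral_Ioi_of_hasDerivAt_of_nonneg' hder hnn hlim
  have hpdf : ∀ x, gaussianPDFReal 0 1 x = (√(2 * Real.pi))⁻¹ * Real.exp (-x ^ 2 / 2) := by
    intro x
    simp [gaussianPDFReal]
  have hreal : (gaussianReal 0 1).real (Ici u) = ∫ x in Ioi u, gaussianPDFReal 0 1 x := by
    rw [measureReal_def, gaussianReal_apply_eq_integral _ one_ne_zero,
      ENNReal.toReal_ofReal (integral_nonneg fun x => gaussianPDFReal_nonneg _ _ _),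
      integral_Ici_eq_integral_Ioi]
  calc (gaussianReal 0 1).real (Ici u) = ∫ x in Ioi u, gaussianPDFReal 0 1 x := hreal
    _ ≤ ∫ x in Ioi u, (u * √(2 * Real.pi))⁻¹ * (x * Real.exp (-x ^ 2 / 2)) := by
        refine setIntegral_mono_on (integrable_gaussianPDFReal 0 1).integrableOn
          (hint.const_mul _) measurableSet_Ioi fun x hx => ?_
        rw [hpdf, mul_inv, mul_comm u⁻¹, mul_assoc, ← mul_assoc u⁻¹]
        have : 1 ≤ u⁻¹ * x := by
          rw [inv_mul_eq_div, one_le_div hu]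
          exact le_of_lt hx
        gcongr
        exact le_mul_of_one_le_left (Real.exp_nonneg _) this
    _ = millsBound u := by
        rw [integral_const_mul, hval, millsBound]
        field_simp
        ring

variable {E : Type*} [NormedAddCommGroup E] [InnerProductSpace ℝ E] [FiniteDimensional ℝ E]
  [MeasurableSpace E] [BorelSpace E]

theorem stdGaussian_map_inner (x : E) :
    (stdGaussian E).map (fun h => inner ℝ x h) = gaussianReal 0 (‖x‖₊ ^ 2) := by
  have h := IsGaussian.map_eq_gaussianReal (μ := stdGaussian E) (innerSL ℝ x)
  rw [variance_dual_stdGaussian, integral_strongDual_stdGaussian] at h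
  simp only [innerSL_apply_norm] at h
  convert! h using 2
  ext
  simp

theorem one_sub_millsBound_le {x : E} (hx : x ≠ 0) {R : ℝ} (hR : 0 < R) :
    1 - millsBound (R / ‖x‖) ≤ (stdGaussian E).real {h | inner ℝ x h < R} := by
  have hx' : 0 < ‖x‖ := norm_pos_iff.2 hx
  have hm : Measurable fun h : E => inner ℝ x h := by fun_prop
  have hscale : gaussianReal 0 (‖x‖₊ ^ 2) = (gaussianReal 0 1).map (‖x‖ * ·) := by
    rw [gaussianReal_map_const_mul]
    congr 1
    · simp
    · ext; simp
  have hset : {h : E | inner ℝ x h < R} = ((fun h => inner ℝ x h) ⁻¹' Ici R)ᶜ := by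
    ext; simp
  have h1 : (stdGaussian E).real ((fun h => inner ℝ x h) ⁻¹' Ici R)
      = (gaussianReal 0 1).real (Ici (R / ‖x‖)) := by
    rw [measureReal_def, ← Measure.map_apply hm measurableSet_Ici, stdGaussian_map_inner, hscale,
      Measure.map_apply (by fun_prop) measurableSet_Ici, measureReal_def]
    congr 2
    ext y
    simp [div_le_iff₀ hx', mul_comm]
  rw [hset, measureReal_compl (hm measurableSet_Ici), h1, probReal_univ]
  linarith [gaussianReal_Ici_le (div_pos hR hx')]

/-- This lets the surface integral over a hyperplane be read as a Gaussian probability. -/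
theorem stdGaussian_eq_withDensity (n : ℕ) :
    stdGaussian (EuclideanSpace ℝ (Fin n)) =
      volume.withDensity fun x => ENNReal.ofReal (gaussianDensity n x) := by
  have hpi : (Measure.pi fun _ : Fin n => gaussianReal 0 1) =
      volume.withDensity fun x => ∏ i, gaussianPDF 0 1 (x i) := by
    refine Measure.pi_eq fun s hs => ?_
    have hmeas : Measurable fun x : Fin n → ℝ => ∏ i, gaussianPDF 0 1 (x i) := by
      refine Finset.measurable_prod _ fun i _ => ?_
      exact (measurable_gaussianPDF 0 1).comp (measurable_pi_apply i)
    rw [withDensity_apply _ (MeasurableSet.univ_pi hs), volume_pi, Measure.restrict_pi_pi]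
    have hprod : ∀ x : Fin n → ℝ, ∏ i, gaussianPDF 0 1 (x i)
        = ENNReal.ofReal (∏ i, gaussianPDFReal 0 1 (x i)) := fun x => by
      rw [ENNReal.ofReal_prod_of_nonneg fun i _ => gaussianPDFReal_nonneg _ _ _]
      rfl
    simp_rw [hprod]
    rw [← ofReal_integral_eq_lintegral_ofReal]
    · rw [integral_fintype_prod_eq_prod (𝕜 := ℝ) (fun _ => gaussianPDFReal 0 1),
        ENNReal.ofReal_prod_of_nonneg fun i _ =>
          integral_nonneg fun x => gaussianPDFReal_nonneg _ _ _]
      exact Finset.prod_congr rfl fun i _ =>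
        (gaussianReal_apply_eq_integral 0 one_ne_zero (s i)).symm
    · exact Integrable.fintype_prod (f := fun _ => gaussianPDFReal 0 1)
        fun i => (integrable_gaussianPDFReal 0 1).integrableOn
    · exact .of_forall fun x => Finset.prod_nonneg fun i _ => gaussianPDFReal_nonneg _ _ _
  have hdens : ∀ x : Fin n → ℝ, ∏ i, gaussianPDF 0 1 (x i)
      = ENNReal.ofReal (gaussianDensity n (WithLp.toLp 2 x)) := fun x => by
    simp only [gaussianPDF]
    rw [← ENNReal.ofReal_prod_of_nonneg fun i _ => gaussianPDFReal_nonneg _ _ _]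
    congr 1
    simp only [gaussianPDFReal, gaussianDensity, Finset.prod_mul_distrib, EuclideanSpace.norm_sq_eq]
    rw [← Real.exp_sum]
    congr 1
    · simp only [NNReal.coe_one, mul_one, Finset.prod_const, Finset.card_univ, Fintype.card_fin]
      rw [Real.sqrt_eq_rpow, ← Real.rpow_neg (by positivity), ← Real.rpow_natCast,
        ← Real.rpow_mul (by positivity)]
      ring_nf
    · simp [← Finset.sum_neg_distrib, Finset.sum_div]
  rw [← map_pi_eq_stdGaussian, hpi]
  ext s hs
  have hvol := PiLp.volume_preserving_toLp (Fin n)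
  rw [Measure.map_apply (by fun_prop) hs, withDensity_apply _ hs,
    withDensity_apply _ (hvol.measurable hs), ← hvol.map_eq, setLIntegral_map hs _ hvol.measurable]
  · simp_rw [hdens]
  · unfold gaussianDensity
    fun_prop

end StdGaussian

theorem measurable_gaussianDensity (n : ℕ) : Measurable (gaussianDensity n) := by
  unfold gaussianDensity
  fun_prop

/-! ### Isometric coordinates on a facet hyperplane -/

/-- The first coordinate vector of `ℝ^(m+1)`. -/
noncomputable def firstVec (m : ℕ) : 𝔼 (m + 1) := EuclideanSpace.single 0 1

/-- The point `(a, y)` of `ℝ^(m+1) = ℝ × ℝ^m`. -/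
noncomputable def consPoint {m : ℕ} (a : ℝ) (y : 𝔼 m) : 𝔼 (m + 1) :=
  WithLp.toLp 2 (Fin.cons a y.ofLp)

theorem inner_firstVec_consPoint {m : ℕ} (a : ℝ) (y : 𝔼 m) :
    inner ℝ (firstVec m) (consPoint a y) = a := by
  simp [firstVec, consPoint, EuclideanSpace.inner_single_left]

theorem norm_firstVec (m : ℕ) : ‖firstVec m‖ = 1 := by simp [firstVec]

theorem norm_sq_consPoint {m : ℕ} (a : ℝ) (y : 𝔼 m) :
    ‖consPoint a y‖ ^ 2 = a ^ 2 + ‖y‖ ^ 2 := by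
  simp [consPoint, EuclideanSpace.norm_sq_eq, Fin.sum_univ_succ]

theorem isometry_consPoint {m : ℕ} (a : ℝ) : Isometry (consPoint (m := m) a) := by
  refine Isometry.of_dist_eq fun x y => ?_
  simp [EuclideanSpace.dist_eq, consPoint, Fin.sum_univ_succ]

/-- The reflection of `ℝ^(m+1)` that exchanges the first coordinate vector with the direction
of `G`. -/
noncomputable def reflectTo {m : ℕ} (G : 𝔼 (m + 1)) : (𝔼 (m + 1)) ≃ₗᵢ[ℝ] 𝔼 (m + 1) :=
  (ℝ ∙ (firstVec m - ‖G‖⁻¹ • G))ᗮ.reflection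

/-- The explicit formula serves to prove measurability in `G` and `x` jointly. If `G` already points
along the first axis, the correction is zero and the division by zero is harmless. -/
theorem reflectTo_apply {m : ℕ} (G x : 𝔼 (m + 1)) :
    reflectTo G x = x - (2 * (inner ℝ (firstVec m - ‖G‖⁻¹ • G) x /
      ‖firstVec m - ‖G‖⁻¹ • G‖ ^ 2)) • (firstVec m - ‖G‖⁻¹ • G) := by
  rw [reflectTo, Submodule.reflection_orthogonal_apply, Submodule.reflection_singleton_apply]
  simp only [neg_sub, two_smul, two_mul, add_smul]
  rfl

theorem reflectTo_firstVec {m : ℕ} {G : 𝔼 (m + 1)} (hG : G ≠ 0) :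
    reflectTo G (firstVec m) = ‖G‖⁻¹ • G := by
  refine Submodule.reflection_sub ?_
  rw [norm_firstVec, norm_smul, norm_inv, norm_norm, inv_mul_cancel₀ (norm_ne_zero_iff.2 hG)]

/-- A parametrization of the hyperplane `⟪x, G⟫ = R` by `ℝ^m`. -/
noncomputable def facetPoint {m : ℕ} (R : ℝ) (G : 𝔼 (m + 1)) (y : 𝔼 m) : 𝔼 (m + 1) :=
  reflectTo G (consPoint (R / ‖G‖) y)

theorem isometry_facetPoint {m : ℕ} (R : ℝ) (G : 𝔼 (m + 1)) : Isometry (facetPoint R G) :=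
  (reflectTo G).isometry.comp (isometry_consPoint _)

theorem norm_sq_facetPoint {m : ℕ} (R : ℝ) (G : 𝔼 (m + 1)) (y : 𝔼 m) :
    ‖facetPoint R G y‖ ^ 2 = (R / ‖G‖) ^ 2 + ‖y‖ ^ 2 := by
  rw [facetPoint, LinearIsometryEquiv.norm_map, norm_sq_consPoint]

theorem inner_facetPoint {m : ℕ} (R : ℝ) {G : 𝔼 (m + 1)} (hG : G ≠ 0) (y : 𝔼 m) :
    inner ℝ (facetPoint R G y) G = R := by
  have hn : ‖G‖ ≠ 0 := norm_ne_zero_iff.2 hG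
  have h : G = ‖G‖ • reflectTo G (firstVec m) := by
    rw [reflectTo_firstVec hG, smul_smul, mul_inv_cancel₀ hn, one_smul]
  calc inner ℝ (facetPoint R G y) G
      = inner ℝ (facetPoint R G y) (‖G‖ • reflectTo G (firstVec m)) := congrArg _ h
    _ = R := by
        rw [facetPoint, inner_smul_right, LinearIsometryEquiv.inner_map_map, real_inner_comm,
          inner_firstVec_consPoint, mul_div_cancel₀ _ hn]

theorem measurable_facetPoint {m : ℕ} (R : ℝ) :
    Measurable fun p : (𝔼 (m + 1)) × (𝔼 m) => facetPoint R p.1 p.2 := by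
  have hc : Measurable fun p : (𝔼 (m + 1)) × (𝔼 m) => consPoint (R / ‖p.1‖) p.2 := by
    unfold consPoint
    refine (WithLp.measurable_toLp 2 _).comp (measurable_pi_iff.2 fun i => ?_)
    refine Fin.cases ?_ (fun j => ?_) i
    · simp only [Fin.cons_zero]
      fun_prop
    · simp only [Fin.cons_succ]
      fun_prop
  simp only [facetPoint, reflectTo_apply]
  fun_prop

theorem gaussianDensity_facetPoint {m : ℕ} (R : ℝ) (G : 𝔼 (m + 1)) (y : 𝔼 m) :
    gaussianDensity (m + 1) (facetPoint R G y) =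
      (√(2 * Real.pi))⁻¹ * Real.exp (-(R / ‖G‖) ^ 2 / 2) * gaussianDensity m y := by
  rw [gaussianDensity, gaussianDensity, norm_sq_facetPoint, Real.sqrt_eq_rpow,
    ← Real.rpow_neg (by positivity)]
  have h1 : -((m + 1 : ℕ) : ℝ) / 2 = -(1 / 2) + -(m : ℝ) / 2 := by push_cast; ring
  have h2 : -((R / ‖G‖) ^ 2 + ‖y‖ ^ 2) / 2 = -(R / ‖G‖) ^ 2 / 2 + -‖y‖ ^ 2 / 2 := by ring
  rw [h1, h2, Real.rpow_add (by positivity), Real.exp_add]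
  ring

open Classical in
/-- The one-dimensional Gaussian weight of the hyperplane `⟪x, G⟫ = R`. -/
noncomputable def facetWeight {m : ℕ} (R : ℝ) (G : 𝔼 (m + 1)) : ℝ≥0∞ :=
  -- For `G = 0` and `R ≠ 0` the hyperplane is empty, whereas `R / 0 = 0` would give it positive
  -- weight.
  if G = 0 then 0 else ENNReal.ofReal ((√(2 * Real.pi))⁻¹ * Real.exp (-(R / ‖G‖) ^ 2 / 2))

theorem measurable_facetWeight {m : ℕ} (R : ℝ) : Measurable (facetWeight (m := m) R) := by
  unfold facetWeight
  refine Measurable.ite (measurableSet_singleton (0 : 𝔼 (m + 1))) measurable_const ?_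
  fun_prop

/-- The part of the hyperplane `⟪x, G⟫ = R` strictly inside the half-spaces `⟪x, H i⟫ < R`. -/
def openFacet {m : ℕ} {ι : Type*} (R : ℝ) (G : 𝔼 (m + 1)) (H : ι → 𝔼 (m + 1)) :
    Set (𝔼 (m + 1)) :=
  {x | inner ℝ x G = R ∧ ∀ i, inner ℝ x (H i) < R}

theorem measurableSet_openFacet {m : ℕ} {ι : Type*} [Countable ι] (R : ℝ) (G : 𝔼 (m + 1))
    (H : ι → 𝔼 (m + 1)) : MeasurableSet (openFacet R G H) := by
  have h : openFacet R G H = {x | inner ℝ x G = R} ∩ ⋂ i, {x | inner ℝ x (H i) < R} := by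
    ext x
    simp [openFacet]
  rw [h]
  exact (measurableSet_eq_fun (by fun_prop) (by fun_prop)).inter
    (MeasurableSet.iInter fun i => measurableSet_lt (by fun_prop) (by fun_prop))

/-- `facetPoint` is an isometry, so it carries Lebesgue measure to Hausdorff measure on its range,
and by Pythagoras the density splits into the weight and the density on `ℝ^m`. -/
theorem facetWeight_mul_le {m : ℕ} {ι : Type*} [Countable ι] (R : ℝ) (G : 𝔼 (m + 1))
    (H : ι → 𝔼 (m + 1)) :
    facetWeight R G * stdGaussian (𝔼 m) {y | ∀ i, inner ℝ (facetPoint R G y) (H i) < R} ≤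
      ∫⁻ x in openFacet R G H, ENNReal.ofReal (gaussianDensity (m + 1) x) ∂(μHE[m]) := by
  by_cases hG : G = 0
  · simp [facetWeight, hG]
  have hiso := isometry_facetPoint R G
  have hS : facetPoint R G ⁻¹' openFacet R G H
      = {y | ∀ i, inner ℝ (facetPoint R G y) (H i) < R} := by
    ext y
    simp [openFacet, inner_facetPoint R hG]
  have hF := measurableSet_openFacet R G H
  have hm := hiso.continuous.measurable
  calc facetWeight R G * stdGaussian (𝔼 m) {y | ∀ i, inner ℝ (facetPoint R G y) (H i) < R}
      = ∫⁻ y in facetPoint R G ⁻¹' openFacet R G H,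
          ENNReal.ofReal (gaussianDensity (m + 1) (facetPoint R G y)) := by
        rw [← hS, stdGaussian_eq_withDensity, withDensity_apply _ (hm hF),
          ← lintegral_const_mul _ (measurable_gaussianDensity m).ennreal_ofReal]
        refine lintegral_congr fun y => ?_
        rw [facetWeight, if_neg hG, ← ENNReal.ofReal_mul (by positivity),
          gaussianDensity_facetPoint]
    _ = ∫⁻ x in openFacet R G H, ENNReal.ofReal (gaussianDensity (m + 1) x)
          ∂(μHE[m].restrict (range (facetPoint R G))) := by
        rw [← hiso.map_euclideanHausdorffMeasure,
          setLIntegral_map hF (measurable_gaussianDensity (m + 1)).ennreal_ofReal hm,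
          EuclideanSpace.euclideanHausdorffMeasure_eq_volume]
    _ ≤ _ := lintegral_mono' (Measure.restrict_mono_measure Measure.restrict_le_self _) le_rfl

/-! ### Surface area of a polytope and its average over random normals -/

/-- The intersection of the half-spaces `⟪x, G j⟫ ≤ R`. -/
def polytope {m : ℕ} {ι : Type*} (R : ℝ) (G : ι → 𝔼 (m + 1)) : Set (𝔼 (m + 1)) :=
  {x | ∀ j, inner ℝ x (G j) ≤ R}

theorem convex_polytope {m : ℕ} {ι : Type*} (R : ℝ) (G : ι → 𝔼 (m + 1)) :
    Convex ℝ (polytope R G) := by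
  simp only [polytope, ofPred_forall]
  refine convex_iInter fun j => ?_
  have : {x : 𝔼 (m + 1) | inner ℝ x (G j) ≤ R} = {x | innerSL ℝ (G j) x ≤ R} := by
    ext x
    simp [real_inner_comm]
  rw [this]
  exact convex_halfSpace_le (innerSL ℝ (G j)).isLinear R

theorem openFacet_subset_frontier {m N : ℕ} {R : ℝ} (hR : 0 < R) (G : Fin (N + 1) → 𝔼 (m + 1))
    (j : Fin (N + 1)) :
    openFacet R (G j) (fun i => G (j.succAbove i)) ⊆ frontier (polytope R G) := by
  rintro x ⟨hx, hx'⟩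
  have hmem : x ∈ polytope R G := by
    intro i
    rcases Fin.eq_self_or_eq_succAbove j i with rfl | ⟨k, rfl⟩
    · exact hx.le
    · exact (hx' k).le
  refine ⟨subset_closure hmem, fun hint => ?_⟩
  -- Moving outwards along the ray through `x` violates constraint `j` at once, because `R > 0`.
  have hpath : Tendsto (fun t : ℝ => (1 + t) • x) (𝓝 0) (𝓝 x) := by
    have : Continuous fun t : ℝ => (1 + t) • x := by fun_prop
    simpa using this.tendsto 0
  have hev : ∀ᶠ t : ℝ in 𝓝[>] 0, (1 + t) • x ∈ polytope R G :=
    (hpath.mono_left nhdsWithin_le_nhds).eventually (mem_interior_iff_mem_nhds.1 hint)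
  obtain ⟨t, ht, ht0⟩ := (hev.and self_mem_nhdsWithin).exists
  have h := ht j
  rw [real_inner_smul_left, hx] at h
  have : 0 < t := ht0
  nlinarith

theorem sum_facet_le_gaussianSurfaceArea {m N : ℕ} {R : ℝ} (hR : 0 < R)
    (G : Fin (N + 1) → 𝔼 (m + 1)) :
    ∑ j, facetWeight R (G j) *
        stdGaussian (𝔼 m) {y | ∀ i, inner ℝ (facetPoint R (G j) y) (G (j.succAbove i)) < R} ≤
      gaussianSurfaceArea (m + 1) (polytope R G) := by
  -- The strict inequalities make the open facets disjoint, even when two normals coincide.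
  have hdisj : Pairwise (Function.onFun Disjoint
      fun j => openFacet R (G j) fun i => G (j.succAbove i)) := by
    intro j k hjk
    refine Set.disjoint_left.2 fun x hxj hxk => ?_
    obtain ⟨i, hi⟩ := Fin.exists_succAbove_eq hjk
    have := hxk.2 i
    simp only [hi] at this
    exact this.ne hxj.1
  calc _ ≤ ∑ j, ∫⁻ x in openFacet R (G j) fun i => G (j.succAbove i),
        ENNReal.ofReal (gaussianDensity (m + 1) x) ∂(μHE[m]) :=
        Finset.sum_le_sum fun j _ => facetWeight_mul_le _ _ _
    _ = ∫⁻ x in ⋃ j, openFacet R (G j) fun i => G (j.succAbove i),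
        ENNReal.ofReal (gaussianDensity (m + 1) x) ∂(μHE[m]) := by
        rw [lintegral_iUnion (fun j => measurableSet_openFacet _ _ _) hdisj, tsum_fintype]
    _ ≤ gaussianSurfaceArea (m + 1) (polytope R G) :=
        lintegral_mono_set (iUnion_subset fun j => openFacet_subset_frontier hR G j)

theorem lintegral_pi_eq_lintegral_prod {α : Type*} [MeasurableSpace α] (μ : Measure α)
    [SigmaFinite μ] {N : ℕ} {f : α × (Fin N → α) → ℝ≥0∞} (hf : Measurable f) (j : Fin (N + 1)) :
    ∫⁻ G, f (G j, fun i => G (j.succAbove i)) ∂(Measure.pi fun _ => μ)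
      = ∫⁻ q, f q ∂(μ.prod (Measure.pi fun _ : Fin N => μ)) :=
  (measurePreserving_piFinSuccAbove (fun _ : Fin (N + 1) => μ) j).lintegral_comp hf

theorem measurableSet_facet_inner_lt (m N : ℕ) (R : ℝ) :
    MeasurableSet {p : ((𝔼 (m + 1)) × (Fin N → 𝔼 (m + 1))) × (𝔼 m) |
      ∀ i, inner ℝ (facetPoint R p.1.1 p.2) (p.1.2 i) < R} := by
  have h : {p : ((𝔼 (m + 1)) × (Fin N → 𝔼 (m + 1))) × (𝔼 m) |
      ∀ i, inner ℝ (facetPoint R p.1.1 p.2) (p.1.2 i) < R}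
      = ⋂ i, {p | inner ℝ (facetPoint R p.1.1 p.2) (p.1.2 i) < R} := by
    ext p
    simp
  rw [h]
  refine MeasurableSet.iInter fun i => ?_
  have h1 : Measurable fun p : ((𝔼 (m + 1)) × (Fin N → 𝔼 (m + 1))) × (𝔼 m) =>
      facetPoint R p.1.1 p.2 := by
    have h0 : Measurable fun p : ((𝔼 (m + 1)) × (Fin N → 𝔼 (m + 1))) × (𝔼 m) => (p.1.1, p.2) :=
      (measurable_fst.comp measurable_fst).prodMk measurable_snd
    have h1 := (measurable_facetPoint (m := m) R).comp h0
    simpa only [Function.comp_def] using h1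
  have h2 : Measurable fun p : ((𝔼 (m + 1)) × (Fin N → 𝔼 (m + 1))) × (𝔼 m) => p.1.2 i :=
    (measurable_pi_apply i).comp (measurable_snd.comp measurable_fst)
  exact measurableSet_lt (h1.inner h2) measurable_const

/-- Average the sum over facets: each has the same mean, and for a fixed point of one facet the
other `N` constraints are independent, hence the power. -/
theorem lintegral_facet_le_maxGaussianSurfaceArea (m N : ℕ) {R : ℝ} (hR : 0 < R) :
    (N + 1) * ∫⁻ G, facetWeight R G * ∫⁻ y,
        stdGaussian (𝔼 (m + 1)) {h | inner ℝ (facetPoint R G y) h < R} ^ N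
        ∂stdGaussian (𝔼 m) ∂stdGaussian (𝔼 (m + 1)) ≤
      maxGaussianSurfaceArea (m + 1) := by
  set μ := stdGaussian (𝔼 (m + 1))
  set ν := stdGaussian (𝔼 m)
  let A : Set (((𝔼 (m + 1)) × (Fin N → 𝔼 (m + 1))) × (𝔼 m)) :=
    {p | ∀ i, inner ℝ (facetPoint R p.1.1 p.2) (p.1.2 i) < R}
  have hA : MeasurableSet A := measurableSet_facet_inner_lt m N R
  let f : (𝔼 (m + 1)) × (Fin N → 𝔼 (m + 1)) → ℝ≥0∞ := fun q =>
    facetWeight R q.1 * ν {y | ∀ i, inner ℝ (facetPoint R q.1 y) (q.2 i) < R}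
  have hf : Measurable f :=
    ((measurable_facetWeight R).comp measurable_fst).mul (measurable_measure_prodMk_left hA)
  have hint : ∀ j : Fin (N + 1),
      ∫⁻ G, f (G j, fun i => G (j.succAbove i)) ∂(Measure.pi fun _ => μ)
        = ∫⁻ G, facetWeight R G * ∫⁻ y, μ {h | inner ℝ (facetPoint R G y) h < R} ^ N ∂ν ∂μ := by
    intro j
    rw [lintegral_pi_eq_lintegral_prod μ hf, lintegral_prod _ hf.aemeasurable]
    refine lintegral_congr fun G => ?_
    have hAG : MeasurableSet {p : (Fin N → 𝔼 (m + 1)) × (𝔼 m) |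
        ∀ i, inner ℝ (facetPoint R G p.2) (p.1 i) < R} := by
      have h0 : Measurable fun p : (Fin N → 𝔼 (m + 1)) × (𝔼 m) => ((G, p.1), p.2) :=
        (measurable_const.prodMk measurable_fst).prodMk measurable_snd
      have h1 := h0 hA
      simpa only [A, preimage_ofPred_eq] using h1
    simp only [f]
    have h2 := measurable_measure_prodMk_left (ν := ν) hAG
    simp only [preimage_ofPred_eq] at h2
    rw [lintegral_const_mul _ h2]
    congr 1
    have h1 := Measure.prod_apply (μ := Measure.pi fun _ : Fin N => μ) (ν := ν) hAG
    rw [Measure.prod_apply_symm hAG] at h1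
    refine h1.symm.trans (lintegral_congr fun y => ?_)
    have hbox : (fun x : Fin N → 𝔼 (m + 1) => (x, y)) ⁻¹'
        {p | ∀ i, inner ℝ (facetPoint R G p.2) (p.1 i) < R}
        = Set.univ.pi fun _ => {h | inner ℝ (facetPoint R G y) h < R} := by
      ext x
      simp
    rw [hbox, Measure.pi_pi, Finset.prod_const, Finset.card_univ, Fintype.card_fin]
  have hle : ∀ G : Fin (N + 1) → 𝔼 (m + 1),
      ∑ j, f (G j, fun i => G (j.succAbove i)) ≤ maxGaussianSurfaceArea (m + 1) := fun G =>
    (sum_facet_le_gaussianSurfaceArea hR G).trans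
      (le_iSup₂_of_le (polytope R G) (convex_polytope R G) le_rfl)
  have hmeas : ∀ j : Fin (N + 1), Measurable fun G : Fin (N + 1) → 𝔼 (m + 1) =>
      f (G j, fun i => G (j.succAbove i)) := fun j => hf.comp (by fun_prop)
  calc _ = ∑ j : Fin (N + 1), ∫⁻ G, f (G j, fun i => G (j.succAbove i))
        ∂(Measure.pi fun _ => μ) := by
        simp [hint]
    _ = ∫⁻ G, ∑ j : Fin (N + 1), f (G j, fun i => G (j.succAbove i))
        ∂(Measure.pi fun _ => μ) := (lintegral_finsetSum _ fun j _ => hmeas j).symm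
    _ ≤ ∫⁻ _, maxGaussianSurfaceArea (m + 1) ∂(Measure.pi fun _ : Fin (N + 1) => μ) :=
        lintegral_mono hle
    _ = maxGaussianSurfaceArea (m + 1) := by simp

/-! ### Central limit theorem for the squared norm -/

theorem integral_pow_four_gaussianReal : ∫ x, x ^ 4 ∂gaussianReal 0 1 = 3 := by
  have hset : (0 : ℝ) ∈ interior (integrableExpSet (id : ℝ → ℝ) (gaussianReal 0 1)) := by
    rw [integrableExpSet_id_gaussianReal]
    simp
  have h := iteratedDeriv_mgf_zero hset 4
  have key : ∀ (p q : ℝ → ℝ), (∀ t, HasDerivAt p (q t) t) →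
      deriv (fun t : ℝ => p t * Real.exp (t ^ 2 / 2))
        = fun t => (q t + t * p t) * Real.exp (t ^ 2 / 2) := by
    intro p q hpq
    ext t
    have h1 : HasDerivAt (fun t : ℝ => Real.exp (t ^ 2 / 2)) (Real.exp (t ^ 2 / 2) * t) t := by
      convert! ((hasDerivAt_pow 2 t).div_const 2).exp using 1
      simp
    have h2 : HasDerivAt (fun t : ℝ => p t * Real.exp (t ^ 2 / 2)) _ t := (hpq t).mul h1
    rw [h2.deriv]
    ring
  have h0 : mgf id (gaussianReal 0 1) = fun t => (1 : ℝ) * Real.exp (t ^ 2 / 2) := by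
    rw [mgf_id_gaussianReal]
    ext t
    simp
  have h1 : deriv (mgf id (gaussianReal 0 1)) = fun t => t * Real.exp (t ^ 2 / 2) := by
    rw [h0, key (fun _ => 1) (fun _ => 0) fun t => hasDerivAt_const t 1]
    simp
  have h2 : deriv (fun t : ℝ => t * Real.exp (t ^ 2 / 2))
      = fun t => (1 + t * t) * Real.exp (t ^ 2 / 2) :=
    key (fun t => t) (fun _ => 1) hasDerivAt_id'
  have h3 : deriv (fun t : ℝ => (1 + t * t) * Real.exp (t ^ 2 / 2))
      = fun t => (2 * t + t * (1 + t * t)) * Real.exp (t ^ 2 / 2) := by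
    refine key (fun t => 1 + t * t) (fun t => 2 * t) fun t => ?_
    convert! ((hasDerivAt_id' t).mul (hasDerivAt_id' t)).const_add 1 using 1
    ring
  have h4 : deriv (fun t : ℝ => (2 * t + t * (1 + t * t)) * Real.exp (t ^ 2 / 2))
      = fun t => (3 + 3 * t ^ 2 + t * (2 * t + t * (1 + t * t))) * Real.exp (t ^ 2 / 2) := by
    refine key (fun t => 2 * t + t * (1 + t * t)) (fun t => 3 + 3 * t ^ 2) fun t => ?_
    convert! ((hasDerivAt_id' t).const_mul 2).add ((hasDerivAt_id' t).mul
      (((hasDerivAt_id' t).mul (hasDerivAt_id' t)).const_add 1)) using 1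
    simp only [Pi.mul_apply]
    ring
  rw [iteratedDeriv_succ, iteratedDeriv_succ, iteratedDeriv_succ, iteratedDeriv_succ,
    iteratedDeriv_zero, h1, h2, h3, h4] at h
  simpa using h.symm

theorem memLp_sq_gaussianReal : MemLp (fun x : ℝ => x ^ 2) 2 (gaussianReal 0 1) := by
  rw [memLp_two_iff_integrable_sq (by fun_prop)]
  have h := (memLp_id_gaussianReal' (μ := 0) (v := 1) 4 (by simp)).integrable_norm_pow (by simp)
  refine h.congr (.of_forall fun x => ?_)
  simp only [id, Real.norm_eq_abs]
  rw [← pow_mul]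
  exact (even_two.mul_left 2).pow_abs x

theorem integral_sq_gaussianReal : ∫ x, x ^ 2 ∂gaussianReal 0 1 = 1 := by
  have h := variance_eq_sub (μ := gaussianReal 0 1) (X := id) (memLp_id_gaussianReal 2)
  rw [variance_id_gaussianReal] at h
  simpa using h.symm

theorem variance_sq_gaussianReal : Var[fun x : ℝ => x ^ 2; gaussianReal 0 1] = 2 := by
  rw [variance_eq_sub memLp_sq_gaussianReal, integral_sq_gaussianReal]
  have : ∀ x : ℝ, ((fun x : ℝ => x ^ 2) ^ 2) x = x ^ 4 := fun x => by
    simp only [Pi.pow_apply]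
    ring
  simp only [this, integral_pow_four_gaussianReal]
  norm_num

/-- The normalized fluctuation of the squared norm on `ℝⁿ`. -/
noncomputable def normFluct (n : ℕ) (x : 𝔼 n) : ℝ := (√n)⁻¹ * (‖x‖ ^ 2 - n)

theorem measurable_normFluct (n : ℕ) : Measurable (normFluct n) := by
  unfold normFluct
  fun_prop

/-- `‖x‖²` is a sum of i.i.d. squares of mean 1 and variance 2. All dimensions are realized on one
infinite product, where the central limit theorem applies. -/
theorem tendsto_integral_normFluct (F : BoundedContinuousFunction ℝ ℝ) :
    Tendsto (fun n => ∫ x, F (normFluct n x) ∂stdGaussian (𝔼 n)) atTop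
      (𝓝 (∫ x, F x ∂gaussianReal 0 2)) := by
  set P := Measure.infinitePi fun _ : ℕ => gaussianReal 0 1
  let X : ℕ → (ℕ → ℝ) → ℝ := fun i ω => ω i ^ 2
  have heval : ∀ i, MeasurePreserving (fun ω : ℕ → ℝ => ω i) P (gaussianReal 0 1) := fun i =>
    measurePreserving_eval_infinitePi (fun _ : ℕ => gaussianReal 0 1) i
  have hindep : iIndepFun X P :=
    iIndepFun_infinitePi (X := fun _ x => x ^ 2) fun _ => by fun_prop
  have hident : ∀ i, IdentDistrib (X i) (X 0) P P := fun i =>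
    IdentDistrib.comp (u := fun x : ℝ => x ^ 2)
      ⟨(heval i).measurable.aemeasurable, (heval 0).measurable.aemeasurable,
        by rw [(heval i).map_eq, (heval 0).map_eq]⟩ (by fun_prop)
  have hL2 : MemLp (X 0) 2 P := memLp_sq_gaussianReal.comp_measurePreserving (heval 0)
  have hmean : ∫ ω, X 0 ω ∂P = 1 := by
    rw [← integral_sq_gaussianReal, ← (heval 0).map_eq,
      integral_map (heval 0).measurable.aemeasurable (by fun_prop)]
  have hvar : Var[X 0; P] = 2 := by
    rw [← variance_sq_gaussianReal, ← (heval 0).map_eq,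
      variance_map (by fun_prop) (heval 0).measurable.aemeasurable]
    rfl
  have hY : HasLaw (id : ℝ → ℝ) (gaussianReal 0 Var[X 0; P].toNNReal) (gaussianReal 0 2) := by
    rw [hvar]
    refine ⟨aemeasurable_id, ?_⟩
    rw [Measure.map_id]
    congr 1
    ext
    simp
  have hclt := (tendstoInDistribution_inv_sqrt_mul_sum_sub hY hL2 hindep hident).tendsto
  have hF := ProbabilityMeasure.tendsto_iff_forall_integral_tendsto.1 hclt F
  simp only [ProbabilityMeasure.coe_mk, Measure.map_id, hmean, mul_one] at hF
  refine hF.congr fun n => ?_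
  have hlaw : stdGaussian (𝔼 n) = P.map fun ω => WithLp.toLp 2 fun i : Fin n => ω i := by
    rw [← map_pi_eq_stdGaussian, ← Measure.infinitePi_eq_pi,
      ← Measure.map_infinitePi_infinitePi_of_inj (P := fun _ : ℕ => gaussianReal 0 1)
        (f := fun i : Fin n => (i : ℕ)) Fin.val_injective, Measure.map_map (by fun_prop)
        (by fun_prop)]
    rfl
  rw [hlaw, integral_map (Measurable.aemeasurable (by fun_prop)), integral_map]
  · refine integral_congr_ae (.of_forall fun ω => ?_)
    simp [normFluct, EuclideanSpace.norm_sq_eq, X, Finset.sum_range]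
  · exact Measurable.aemeasurable (by fun_prop)
  · exact (F.continuous.measurable.comp (measurable_normFluct n)).aestronglyMeasurable
  · exact F.continuous.aestronglyMeasurable

/-- The right side is even in `u` and increasing on `[0, ∞)`, where its derivative is nonnegative
because `u ≤ sinh u`; so its minimum is at 0. -/
theorem two_mul_exp_neg_one_le (u : ℝ) :
    2 * Real.exp (-1) ≤ Real.exp (-Real.exp u) + Real.exp (-Real.exp (-u)) := by
  set g : ℝ → ℝ := fun u => Real.exp (-Real.exp u) + Real.exp (-Real.exp (-u)) with hg
  have hder : ∀ u, HasDerivAt g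
      (-Real.exp (u - Real.exp u) + Real.exp (-u - Real.exp (-u))) u := by
    intro u
    have h1 := (Real.hasDerivAt_exp u).neg.exp
    have h2 := ((hasDerivAt_id' u).neg.exp).neg.exp
    convert! h1.add h2 using 1
    simp only [Pi.neg_apply]
    rw [sub_eq_add_neg, sub_eq_add_neg, Real.exp_add, Real.exp_add]
    ring
  have hmono : MonotoneOn g (Ici 0) := by
    refine monotoneOn_of_deriv_nonneg (convex_Ici 0)
      (fun u _ => (hder u).continuousAt.continuousWithinAt)
      (fun u _ => (hder u).differentiableAt.differentiableWithinAt) fun u hu => ?_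
    rw [interior_Ici] at hu
    have hs := Real.self_le_sinh_iff.2 (le_of_lt (mem_Ioi.1 hu))
    rw [Real.sinh_eq] at hs
    have : Real.exp (u - Real.exp u) ≤ Real.exp (-u - Real.exp (-u)) :=
      Real.exp_le_exp.2 (by linarith)
    rw [(hder u).deriv]
    linarith
  have h0 : g 0 = 2 * Real.exp (-1) := by
    simp only [hg, neg_zero, Real.exp_zero]
    ring
  have habs : g |u| = g u := by
    rcases abs_choice u with h | h
    · rw [h]
    · rw [h]
      simp only [hg, neg_neg]
      ring
  rw [← h0]
  refine le_of_le_of_eq ?_ habs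
  exact hmono (mem_Ici.2 le_rfl) (mem_Ici.2 (abs_nonneg u)) (abs_nonneg u)

theorem integrable_exp_neg_exp (μ : Measure ℝ) [IsFiniteMeasure μ] (c : ℝ) :
    Integrable (fun x => Real.exp (-Real.exp (c * x))) μ := by
  refine Integrable.of_bound (by fun_prop) 1 (.of_forall fun x => ?_)
  rw [Real.norm_of_nonneg (Real.exp_nonneg _), Real.exp_le_one_iff, neg_nonpos]
  exact Real.exp_nonneg _

theorem exp_neg_one_le_integral (v : NNReal) (c : ℝ) :
    Real.exp (-1) ≤ ∫ x, Real.exp (-Real.exp (c * x)) ∂gaussianReal 0 v := by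
  have hneg : ∫ x, Real.exp (-Real.exp (c * x)) ∂gaussianReal 0 v
      = ∫ x, Real.exp (-Real.exp (-(c * x))) ∂gaussianReal 0 v := by
    conv_lhs => rw [← neg_zero, ← gaussianReal_map_neg]
    rw [integral_map (by fun_prop) (by fun_prop)]
    simp only [mul_neg]
  have hint := integrable_exp_neg_exp (gaussianReal 0 v)
  have hint' : Integrable (fun x => Real.exp (-Real.exp (-(c * x)))) (gaussianReal 0 v) := by
    simpa only [neg_mul] using hint (-c)
  have h : ∫ _, 2 * Real.exp (-1) ∂gaussianReal 0 v ≤ ∫ x, (Real.exp (-Real.exp (c * x)) +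
      Real.exp (-Real.exp (-(c * x)))) ∂gaussianReal 0 v :=
    integral_mono (integrable_const _) ((hint c).add hint') fun x => two_mul_exp_neg_one_le _
  rw [integral_add (hint c) hint', ← hneg] at h
  simp only [integral_const, probReal_univ, one_smul] at h
  linarith

/-! ### Truncated weights and their limiting integrals -/

/-- A continuous cutoff supported in `[-A, A]`. -/
noncomputable def cutoff (A x : ℝ) : ℝ := max 0 (1 - |x| / A)

theorem cutoff_nonneg (A x : ℝ) : 0 ≤ cutoff A x := le_max_left _ _

theorem cutoff_le_one {A : ℝ} (hA : 0 < A) (x : ℝ) : cutoff A x ≤ 1 :=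
  max_le zero_le_one (sub_le_self _ (by positivity))

theorem continuous_cutoff (A : ℝ) : Continuous (cutoff A) := by
  unfold cutoff
  fun_prop

theorem abs_le_of_cutoff_ne_zero {A x : ℝ} (hA : 0 < A) (h : cutoff A x ≠ 0) : |x| ≤ A := by
  by_contra! hx
  refine h (max_eq_left ?_)
  have := (one_le_div hA).2 hx.le
  linarith

theorem tendsto_cutoff (x : ℝ) : Tendsto (fun k : ℕ => cutoff (k + 1) x) atTop (𝓝 1) := by
  have h : Tendsto (fun k : ℕ => |x| / ((k : ℝ) + 1)) atTop (𝓝 0) :=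
    tendsto_const_nhds.div_atTop (tendsto_natCast_atTop_atTop.atTop_add tendsto_const_nhds)
  have := (tendsto_const_nhds (x := (0 : ℝ))).max ((tendsto_const_nhds (x := (1 : ℝ))).sub h)
  simpa [cutoff] using this

/-- The truncated limiting weight of a facet. -/
noncomputable def weightFun (A x : ℝ) : ℝ := cutoff A x * Real.exp (x / 2)

/-- The truncated limiting probability that a point of a facet lies in the polytope. -/
noncomputable def insideFun (A ε x : ℝ) : ℝ :=
  cutoff A x * Real.exp (-((1 + ε) * Real.exp (x / 2)))

theorem weightFun_nonneg (A x : ℝ) : 0 ≤ weightFun A x :=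
  mul_nonneg (cutoff_nonneg _ _) (Real.exp_nonneg _)

theorem insideFun_nonneg (A ε x : ℝ) : 0 ≤ insideFun A ε x :=
  mul_nonneg (cutoff_nonneg _ _) (Real.exp_nonneg _)

theorem weightFun_le {A : ℝ} (hA : 0 < A) (x : ℝ) : weightFun A x ≤ Real.exp (x / 2) :=
  mul_le_of_le_one_left (Real.exp_nonneg _) (cutoff_le_one hA x)

theorem weightFun_le_exp {A : ℝ} (hA : 0 < A) (x : ℝ) : weightFun A x ≤ Real.exp (A / 2) := by
  by_cases h : cutoff A x = 0
  · simp [weightFun, h, Real.exp_nonneg]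
  · refine (weightFun_le hA x).trans (Real.exp_le_exp.2 ?_)
    linarith [(le_abs_self x).trans (abs_le_of_cutoff_ne_zero hA h)]

theorem insideFun_le_one {A ε : ℝ} (hA : 0 < A) (hε : 0 ≤ ε) (x : ℝ) : insideFun A ε x ≤ 1 := by
  refine mul_le_one₀ (cutoff_le_one hA x) (Real.exp_nonneg _) ?_
  rw [Real.exp_le_one_iff, neg_nonpos]
  positivity

theorem continuous_weightFun (A : ℝ) : Continuous (weightFun A) :=
  (continuous_cutoff A).mul (by fun_prop)

theorem continuous_insideFun (A ε : ℝ) : Continuous (insideFun A ε) :=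
  (continuous_cutoff A).mul (by fun_prop)

/-- Weak convergence only tests bounded functions, and `e^(x/2)` is unbounded; the cutoff repairs
this. -/
theorem tendsto_integral_weightFun_normFluct {A : ℝ} (hA : 0 < A) :
    Tendsto (fun n => ∫ x, weightFun A (normFluct n x) ∂stdGaussian (𝔼 n)) atTop
      (𝓝 (∫ x, weightFun A x ∂gaussianReal 0 2)) :=
  tendsto_integral_normFluct (.ofNormedAddCommGroup (weightFun A) (continuous_weightFun A)
    (Real.exp (A / 2)) fun x => by
      rw [Real.norm_of_nonneg (weightFun_nonneg A x)]
      exact weightFun_le_exp hA x)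

theorem tendsto_integral_insideFun_normFluct {A ε : ℝ} (hA : 0 < A) (hε : 0 ≤ ε) :
    Tendsto (fun n => ∫ x, insideFun A ε (normFluct n x) ∂stdGaussian (𝔼 n)) atTop
      (𝓝 (∫ x, insideFun A ε x ∂gaussianReal 0 2)) :=
  tendsto_integral_normFluct (.ofNormedAddCommGroup (insideFun A ε) (continuous_insideFun A ε)
    1 fun x => by
      rw [Real.norm_of_nonneg (insideFun_nonneg A ε x)]
      exact insideFun_le_one hA hε x)

theorem tendsto_integral_weightFun :
    Tendsto (fun k : ℕ => ∫ x, weightFun (k + 1) x ∂gaussianReal 0 2) atTop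
      (𝓝 (Real.exp (1 / 4))) := by
  have hval : ∫ x, Real.exp (x / 2) ∂gaussianReal 0 2 = Real.exp (1 / 4) := by
    have h := congrFun (mgf_id_gaussianReal (μ := 0) (v := 2)) (1 / 2)
    simp only [mgf, id] at h
    convert! h using 1
    · refine integral_congr_ae (.of_forall fun x => ?_)
      simp only
      congr 1
      ring
    · congr 1
      norm_num
  have hint : Integrable (fun x => Real.exp (x / 2)) (gaussianReal 0 2) := by
    refine (integrable_exp_mul_gaussianReal (μ := 0) (v := 2) (1 / 2)).congr
      (.of_forall fun x => ?_)
    simp only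
    congr 1
    ring
  rw [← hval]
  refine tendsto_integral_of_dominated_convergence _
    (fun k => (continuous_weightFun _).aestronglyMeasurable) hint (fun k => .of_forall fun x => ?_)
    (.of_forall fun x => ?_)
  · rw [Real.norm_of_nonneg (weightFun_nonneg _ _)]
    exact weightFun_le (by positivity) x
  · simpa [weightFun] using (tendsto_cutoff x).mul_const (Real.exp (x / 2))

theorem tendsto_integral_insideFun :
    Tendsto (fun k : ℕ => ∫ x, insideFun (k + 1) (1 / ((k : ℝ) + 1)) x ∂gaussianReal 0 2) atTop
      (𝓝 (∫ x, Real.exp (-Real.exp (1 / 2 * x)) ∂gaussianReal 0 2)) := by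
  refine tendsto_integral_of_dominated_convergence (fun _ => 1)
    (fun k => (continuous_insideFun _ _).aestronglyMeasurable) (integrable_const _)
    (fun k => .of_forall fun x => ?_) (.of_forall fun x => ?_)
  · rw [Real.norm_of_nonneg (insideFun_nonneg _ _ _)]
    exact insideFun_le_one (by positivity) (by positivity) x
  · have h1 : Tendsto (fun k : ℕ => -((1 + 1 / ((k : ℝ) + 1)) * Real.exp (x / 2))) atTop
        (𝓝 (-((1 + 0) * Real.exp (x / 2)))) :=
      ((tendsto_const_nhds.add tendsto_one_div_add_atTop_nhds_zero_nat).mul_const _).neg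
    have h2 := (tendsto_cutoff x).mul ((Real.continuous_exp.tendsto _).comp h1)
    convert! h2 using 2
    rw [one_mul, add_zero, one_mul, one_div, inv_mul_eq_div]

/-! ### Asymptotics of the tail bound, uniformly in the fluctuation -/

/-- An upper bound for the squared norm of a point of a facet, where `s = √n`, the fluctuation of
the normal vector is at most `A`, and that of the parameter of the point is `Y`. -/
noncomputable def radiusSqBound (A s Y : ℝ) : ℝ := s ^ 2 + √(s ^ 2 - 1) * Y + s + 2 * A

/-- The approximate number of facets, where `s = √n`. -/
noncomputable def facetCount (s : ℝ) : ℝ := √(2 * Real.pi) * √s * Real.exp ((s - 1) / 2)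

theorem facetCount_nonneg (s : ℝ) : 0 ≤ facetCount s := by
  unfold facetCount
  positivity

theorem tendsto_facetCount : Tendsto facetCount atTop atTop := by
  refine Tendsto.atTop_mul_atTop₀ (Tendsto.const_mul_atTop (by positivity)
    Real.tendsto_sqrt_atTop) (Real.tendsto_exp_atTop.comp ?_)
  exact (tendsto_atTop_add_const_right _ _ tendsto_id).atTop_div_const two_pos

theorem tendsto_mul_of_tendsto_zero_of_mem_Icc {A : ℝ} {f : ℝ × ℝ → ℝ}
    (hf : Tendsto f (atTop ×ˢ 𝓟 (Icc (-A) A)) (𝓝 0)) :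
    Tendsto (fun p => f p * p.2) (atTop ×ˢ 𝓟 (Icc (-A) A)) (𝓝 0) := by
  have hb : Tendsto (fun p => ‖f p‖ * A) (atTop ×ˢ 𝓟 (Icc (-A) A)) (𝓝 0) := by
    simpa using hf.norm.mul_const A
  refine squeeze_zero_norm' ?_ hb
  refine eventually_prod_principal_iff.2 (.of_forall fun s Y hY => ?_)
  rw [norm_mul]
  exact mul_le_mul_of_nonneg_left (abs_le.2 hY) (norm_nonneg _)

theorem tendsto_radiusSqBound (A : ℝ) :
    Tendsto (fun p : ℝ × ℝ => (radiusSqBound A p.1 p.2 - p.1 ^ 2) / p.1 - 1 - p.2)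
      (atTop ×ˢ 𝓟 (Icc (-A) A)) (𝓝 0) := by
  have hs : Tendsto (fun p : ℝ × ℝ => p.1) (atTop ×ˢ 𝓟 (Icc (-A) A)) atTop := tendsto_fst
  have h1 : Tendsto (fun s : ℝ => √(1 - (s ^ 2)⁻¹) - 1) atTop (𝓝 0) := by
    have h : Tendsto (fun s : ℝ => (s ^ 2)⁻¹) atTop (𝓝 0) :=
      (tendsto_pow_atTop two_ne_zero).inv_tendsto_atTop
    have := (Real.continuous_sqrt.tendsto _).comp ((tendsto_const_nhds (x := (1 : ℝ))).sub h)
    simpa using this.sub_const 1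
  have h2 : Tendsto (fun s : ℝ => 2 * A / s) atTop (𝓝 0) :=
    tendsto_const_nhds.div_atTop tendsto_id
  have h3 := (tendsto_mul_of_tendsto_zero_of_mem_Icc (h1.comp hs)).add (h2.comp hs)
  rw [add_zero] at h3
  refine h3.congr' ?_
  filter_upwards [hs.eventually_gt_atTop 0] with p hp
  have h4 : √(p.1 ^ 2 - 1) = p.1 * √(1 - (p.1 ^ 2)⁻¹) := by
    have : p.1 ^ 2 - 1 = p.1 ^ 2 * (1 - (p.1 ^ 2)⁻¹) := by field_simp
    rw [this, Real.sqrt_mul (by positivity), Real.sqrt_sq hp.le]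
  simp only [Function.comp, radiusSqBound, h4]
  field_simp
  ring

theorem tendsto_radiusSqBound_div_sq (A : ℝ) :
    Tendsto (fun p : ℝ × ℝ => radiusSqBound A p.1 p.2 / p.1 ^ 2)
      (atTop ×ˢ 𝓟 (Icc (-A) A)) (𝓝 1) := by
  have hs : Tendsto (fun p : ℝ × ℝ => p.1) (atTop ×ˢ 𝓟 (Icc (-A) A)) atTop := tendsto_fst
  have hinv : Tendsto (fun p : ℝ × ℝ => p.1⁻¹) (atTop ×ˢ 𝓟 (Icc (-A) A)) (𝓝 0) :=
    tendsto_inv_atTop_zero.comp hs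
  have h := (((tendsto_radiusSqBound A).mul hinv).add hinv).add
    (tendsto_mul_of_tendsto_zero_of_mem_Icc hinv) |>.const_add 1
  simp only [mul_zero, add_zero] at h
  refine h.congr' ?_
  filter_upwards [hs.eventually_gt_atTop 0] with p hp
  field_simp
  ring

/-- With `w` the squared radius over `s²`, the Mills exponent is `-s / (2w)` and `s - s / w = D / w
→ 1 + Y`. Hence the bound equals `L e^(Y/2) / facetCount s` with `L → 1`. The filter `atTop ×ˢ 𝓟
(Icc (-A) A)` encodes uniformity in `Y`. -/
theorem eventually_millsBound_le {A ε : ℝ} (hε : 0 < ε) :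
    ∀ᶠ s in atTop, ∀ Y ∈ Icc (-A) A, 0 < radiusSqBound A s Y ∧
      millsBound (√(s ^ 3) / √(radiusSqBound A s Y)) < 1 ∧
      facetCount s * millsBound (√(s ^ 3) / √(radiusSqBound A s Y)) /
        (1 - millsBound (√(s ^ 3) / √(radiusSqBound A s Y))) ≤ (1 + ε) * Real.exp (Y / 2) := by
  set l : Filter (ℝ × ℝ) := atTop ×ˢ 𝓟 (Icc (-A) A)
  have hs : Tendsto (fun p : ℝ × ℝ => p.1) l atTop := tendsto_fst
  let w : ℝ × ℝ → ℝ := fun p => radiusSqBound A p.1 p.2 / p.1 ^ 2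
  let D : ℝ × ℝ → ℝ := fun p => (radiusSqBound A p.1 p.2 - p.1 ^ 2) / p.1
  have hw : Tendsto w l (𝓝 1) := tendsto_radiusSqBound_div_sq A
  have hwi : Tendsto (fun p => (w p)⁻¹ - 1) l (𝓝 0) := by
    simpa using (hw.inv₀ one_ne_zero).sub_const 1
  have hE : Tendsto (fun p => D p / w p - 1 - p.2) l (𝓝 0) := by
    have h := (((tendsto_radiusSqBound A).div hw one_ne_zero).add hwi).add
      (tendsto_mul_of_tendsto_zero_of_mem_Icc hwi)
    simp only [zero_div, add_zero] at h
    refine h.congr fun p => ?_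
    simp only [D, Pi.div_apply]
    ring
  let L : ℝ × ℝ → ℝ := fun p => √(w p) * Real.exp ((D p / w p - 1 - p.2) / 2)
  have hL : Tendsto L l (𝓝 1) := by
    have h := ((Real.continuous_sqrt.tendsto _).comp hw).mul
      ((Real.continuous_exp.tendsto _).comp (hE.div_const 2))
    simpa [L] using h
  have hM : ∀ᶠ p in l, millsBound (√(p.1 ^ 3) / √(radiusSqBound A p.1 p.2))
      = (facetCount p.1)⁻¹ * (L p * Real.exp (p.2 / 2)) := by
    filter_upwards [hs.eventually_gt_atTop 0, hw.eventually_const_lt zero_lt_one] with p hp hwp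
    have hT : 0 < radiusSqBound A p.1 p.2 := by
      have : radiusSqBound A p.1 p.2 = w p * p.1 ^ 2 := by
        simp only [w]
        field_simp
      rw [this]
      positivity
    have h1 : L p * Real.exp (p.2 / 2) = √(w p) * Real.exp ((p.1 - 1) / 2) *
        Real.exp (-(√(p.1 ^ 3) / √(radiusSqBound A p.1 p.2)) ^ 2 / 2) := by
      simp only [L]
      rw [mul_assoc, mul_assoc, ← Real.exp_add, ← Real.exp_add, div_pow,
        Real.sq_sqrt (by positivity), Real.sq_sqrt hT.le]
      congr 2
      simp only [D, w]
      field_simp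
      ring
    have h2 : √(w p) = √(radiusSqBound A p.1 p.2) / p.1 := by
      simp only [w]
      rw [Real.sqrt_div hT.le, Real.sqrt_sq hp.le]
    have h3 : √(p.1 ^ 3) = p.1 * √p.1 := by
      rw [pow_succ, Real.sqrt_mul (by positivity), Real.sqrt_sq hp.le]
    rw [h1, h2, millsBound, facetCount, h3]
    have : 0 < √p.1 := Real.sqrt_pos.2 hp
    have : 0 < √(radiusSqBound A p.1 p.2) := Real.sqrt_pos.2 hT
    field_simp
  have hM0 : Tendsto (fun p => (facetCount p.1)⁻¹ * (L p * Real.exp (p.2 / 2))) l (𝓝 0) := by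
    have hb : Tendsto (fun p => (facetCount p.1)⁻¹ * (L p * Real.exp (A / 2))) l (𝓝 0) := by
      have h := ((tendsto_inv_atTop_zero.comp tendsto_facetCount).comp hs).mul
        (hL.mul_const (Real.exp (A / 2)))
      rwa [zero_mul] at h
    refine squeeze_zero' (.of_forall fun p => ?_)
      (eventually_prod_principal_iff.2 (.of_forall fun s Y hY => ?_)) hb
    · exact mul_nonneg (inv_nonneg.2 (facetCount_nonneg _)) (by positivity)
    · refine mul_le_mul_of_nonneg_left ?_ (inv_nonneg.2 (facetCount_nonneg _))
      refine mul_le_mul_of_nonneg_left (Real.exp_le_exp.2 ?_) (by positivity)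
      linarith [hY.2]
  have hfin : Tendsto (fun p => L p / (1 - (facetCount p.1)⁻¹ * (L p * Real.exp (p.2 / 2)))) l
      (𝓝 1) := by
    have h := hL.div ((tendsto_const_nhds (x := (1 : ℝ))).sub hM0) (by norm_num)
    rwa [sub_zero, div_one] at h
  suffices h : ∀ᶠ p in l, 0 < radiusSqBound A p.1 p.2 ∧
      millsBound (√(p.1 ^ 3) / √(radiusSqBound A p.1 p.2)) < 1 ∧
      facetCount p.1 * millsBound (√(p.1 ^ 3) / √(radiusSqBound A p.1 p.2)) /
        (1 - millsBound (√(p.1 ^ 3) / √(radiusSqBound A p.1 p.2))) ≤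
          (1 + ε) * Real.exp (p.2 / 2) from
    eventually_prod_principal_iff.1 h
  filter_upwards [hM, hM0.eventually_lt_const zero_lt_one,
    hfin.eventually_lt_const (lt_add_of_pos_right 1 hε), hs.eventually_gt_atTop 0,
    hw.eventually_const_lt zero_lt_one] with p h1 h2 h3 h4 h5
  have hc : 0 < facetCount p.1 := by
    unfold facetCount
    positivity
  refine ⟨?_, h1 ▸ h2, ?_⟩
  · by_contra! hneg
    exact absurd (div_nonpos_of_nonpos_of_nonneg hneg (by positivity)) (not_le.2 h5)
  · rw [h1, mul_inv_cancel_left₀ hc.ne', mul_div_right_comm]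
    exact mul_le_mul_of_nonneg_right h3.le (Real.exp_nonneg _)

/-- From `1 / (1 - x) = 1 + x / (1 - x) ≤ e^(x / (1 - x))`. -/
theorem exp_neg_le_one_sub_pow {x b : ℝ} (hx : x < 1) {N : ℕ} (h : N * x / (1 - x) ≤ b) :
    Real.exp (-b) ≤ (1 - x) ^ N := by
  have h1 : 0 < 1 - x := by linarith
  have h2 : Real.exp (-(x / (1 - x))) ≤ 1 - x := by
    rw [Real.exp_neg]
    refine inv_le_of_inv_le₀ h1 ?_
    have := Real.add_one_le_exp (x / (1 - x))
    refine le_trans (le_of_eq ?_) this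
    field_simp
    ring
  calc Real.exp (-b) ≤ Real.exp (N * -(x / (1 - x))) := by
        refine Real.exp_le_exp.2 ?_
        rw [mul_neg, ← mul_div_assoc]
        linarith
    _ = Real.exp (-(x / (1 - x))) ^ N := Real.exp_nat_mul _ _
    _ ≤ (1 - x) ^ N := by gcongr

theorem millsBound_anti {u v : ℝ} (hu : 0 < u) (huv : u ≤ v) : millsBound v ≤ millsBound u := by
  unfold millsBound
  gcongr

theorem millsBound_nonneg {u : ℝ} (hu : 0 ≤ u) : 0 ≤ millsBound u := by
  unfold millsBound
  positivity

/-! ### Finite-dimensional estimates and the limit -/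

theorem norm_sq_eq_normFluct {n : ℕ} (hn : 0 < n) (x : 𝔼 n) :
    ‖x‖ ^ 2 = n + √n * normFluct n x := by
  have : 0 < √(n : ℝ) := Real.sqrt_pos.2 (by exact_mod_cast hn)
  rw [normFluct, mul_inv_cancel_left₀ this.ne']
  ring

theorem le_facetWeight {m : ℕ} {A s : ℝ} (hs : s = √((m + 1 : ℕ) : ℝ)) (hA : 0 < A) (hAs : A < s)
    (G : 𝔼 (m + 1)) :
    ENNReal.ofReal ((√(2 * Real.pi))⁻¹ * Real.exp (-s / 2) * Real.exp (-(A ^ 2 / (2 * (s - A)))) *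
      weightFun A (normFluct (m + 1) G)) ≤ facetWeight (√(s ^ 3)) G := by
  set X := normFluct (m + 1) G with hX
  by_cases hc : cutoff A X = 0
  · simp [weightFun, hc]
  have hXA := abs_le.1 (abs_le_of_cutoff_ne_zero hA hc)
  have hs0 : 0 < s := hA.trans hAs
  have hsX : 0 < s + X := by linarith
  have hG2 : ‖G‖ ^ 2 = s * (s + X) := by
    rw [norm_sq_eq_normFluct m.succ_pos, hX, ← hs]
    have : s ^ 2 = ((m + 1 : ℕ) : ℝ) := by rw [hs, Real.sq_sqrt (by positivity)]
    rw [← this]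
    ring
  have hG : G ≠ 0 := by
    rintro rfl
    rw [norm_zero] at hG2
    have : 0 < s * (s + X) := by positivity
    linarith
  rw [facetWeight, if_neg hG]
  refine ENNReal.ofReal_le_ofReal ?_
  rw [mul_assoc, mul_assoc]
  refine mul_le_mul_of_nonneg_left ?_ (by positivity)
  calc _ ≤ Real.exp (-s / 2) * (Real.exp (-(A ^ 2 / (2 * (s - A)))) * Real.exp (X / 2)) := by
        gcongr
        exact weightFun_le hA X
    _ ≤ _ := by
        rw [← Real.exp_add, ← Real.exp_add, Real.exp_le_exp, div_pow, hG2,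
          Real.sq_sqrt (by positivity)]
        -- The last term is the error that the factor with `A ^ 2 / (2 * (s - A))` absorbs.
        have h1 : s ^ 3 / (s * (s + X)) = s - X + X ^ 2 / (s + X) := by
          field_simp
          ring
        have h2 : X ^ 2 / (s + X) ≤ A ^ 2 / (s - A) := by
          have : X ^ 2 ≤ A ^ 2 := sq_le_sq' hXA.1 hXA.2
          have : 0 < s - A := by linarith
          have : s - A ≤ s + X := by linarith
          gcongr
        have h3 : A ^ 2 / (2 * (s - A)) = A ^ 2 / (s - A) / 2 := by
          rw [div_div, mul_comm]
        rw [h1, h3]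
        linarith

theorem norm_sq_facetPoint_le {m : ℕ} (hm : 0 < m) {A s : ℝ} (hs : s = √((m + 1 : ℕ) : ℝ))
    (hA : 0 < A) (hAs : 2 * A ≤ s) {G : 𝔼 (m + 1)} (hG : |normFluct (m + 1) G| ≤ A) (y : 𝔼 m) :
    0 < ‖facetPoint (√(s ^ 3)) G y‖ ^ 2 ∧
      ‖facetPoint (√(s ^ 3)) G y‖ ^ 2 ≤ radiusSqBound A s (normFluct m y) := by
  have hX := abs_le.1 hG
  set X := normFluct (m + 1) G with hX'
  have hs0 : 0 < s := by linarith
  have hsX : 0 < s + X := by linarith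
  have hs2 : s ^ 2 = (m : ℝ) + 1 := by
    rw [hs, Real.sq_sqrt (by positivity)]
    push_cast
    ring
  have hG2 : ‖G‖ ^ 2 = s * (s + X) := by
    rw [norm_sq_eq_normFluct m.succ_pos, hX', ← hs]
    push_cast
    rw [← hs2]
    ring
  have hm2 : √(s ^ 2 - 1) = √(m : ℝ) := by rw [hs2, add_sub_cancel_right]
  have h1 : s ^ 3 / (s * (s + X)) ≤ s + 2 * A := by
    rw [div_le_iff₀ (by positivity)]
    -- The difference is `A (s - 2A)`, which is where `2A ≤ s` enters.
    have h2 : s * s ≤ (s + 2 * A) * (s - A) := by nlinarith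
    have h3 : (s + 2 * A) * (s - A) ≤ (s + 2 * A) * (s + X) := by
      gcongr
      linarith
    nlinarith
  rw [norm_sq_facetPoint, div_pow, hG2, Real.sq_sqrt (by positivity)]
  refine ⟨by positivity, ?_⟩
  rw [norm_sq_eq_normFluct hm y, radiusSqBound, hm2, hs2]
  linarith

theorem eventually_insideFun_le {A ε : ℝ} (hA : 0 < A) (hε : 0 < ε) :
    ∀ᶠ m : ℕ in atTop, ∀ s : ℝ, s = √((m + 1 : ℕ) : ℝ) → ∀ G : 𝔼 (m + 1),
      |normFluct (m + 1) G| ≤ A → ∀ y : 𝔼 m,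
      ENNReal.ofReal (insideFun A ε (normFluct m y)) ≤
        stdGaussian (𝔼 (m + 1)) {h | inner ℝ (facetPoint (√(s ^ 3)) G y) h < √(s ^ 3)} ^
          ⌊facetCount s⌋₊ := by
  have hs : Tendsto (fun m : ℕ => √((m + 1 : ℕ) : ℝ)) atTop atTop :=
    Real.tendsto_sqrt_atTop.comp (tendsto_natCast_atTop_atTop.comp (tendsto_add_atTop_nat 1))
  filter_upwards [hs.eventually (eventually_millsBound_le (A := A) hε),
    hs.eventually_ge_atTop (2 * A), eventually_gt_atTop 0] with m h1 h2 hm s hsm G hG y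
  rw [← hsm] at h1 h2
  by_cases hc : cutoff A (normFluct m y) = 0
  · simp [insideFun, hc]
  obtain ⟨hT, hM1, hM2⟩ := h1 _ (abs_le.1 (abs_le_of_cutoff_ne_zero hA hc))
  obtain ⟨hx0, hxT⟩ := norm_sq_facetPoint_le hm hsm hA h2 hG y
  have hs0 : 0 < s := by linarith
  have hR : 0 < √(s ^ 3) := Real.sqrt_pos.2 (by positivity)
  set x := facetPoint (√(s ^ 3)) G y
  set M := millsBound (√(s ^ 3) / √(radiusSqBound A s (normFluct m y)))
  have hxn : 0 < ‖x‖ := by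
    by_contra! h
    simp [le_antisymm h (norm_nonneg _)] at hx0
  have hx : x ≠ 0 := norm_pos_iff.1 hxn
  have hle : millsBound (√(s ^ 3) / ‖x‖) ≤ M := by
    refine millsBound_anti (by positivity) ?_
    gcongr
    exact Real.le_sqrt_of_sq_le hxT
  have hM0 : 0 ≤ M := millsBound_nonneg (by positivity)
  have hprob : 1 - M ≤ (stdGaussian (𝔼 (m + 1))).real {h | inner ℝ x h < √(s ^ 3)} := by
    linarith [one_sub_millsBound_le hx hR]
  have hpow : insideFun A ε (normFluct m y) ≤
      (stdGaussian (𝔼 (m + 1))).real {h | inner ℝ x h < √(s ^ 3)} ^ ⌊facetCount s⌋₊ := by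
    calc insideFun A ε (normFluct m y)
        ≤ Real.exp (-((1 + ε) * Real.exp (normFluct m y / 2))) :=
          mul_le_of_le_one_left (Real.exp_nonneg _) (cutoff_le_one hA _)
      _ ≤ (1 - M) ^ ⌊facetCount s⌋₊ := by
          refine exp_neg_le_one_sub_pow hM1 (le_trans ?_ hM2)
          have : 0 < 1 - M := by linarith
          gcongr
          exact Nat.floor_le (facetCount_nonneg s)
      _ ≤ _ := by
          have : 0 ≤ 1 - M := by linarith
          gcongr
  refine (ENNReal.ofReal_le_ofReal hpow).trans_eq ?_
  rw [ENNReal.ofReal_pow measureReal_nonneg, ofReal_measureReal]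

theorem eventually_le_maxGaussianSurfaceArea_div {A ε : ℝ} (hA : 0 < A) (hε : 0 < ε) :
    ∀ᶠ m : ℕ in atTop, ENNReal.ofReal (Real.exp (-1 / 2) *
        Real.exp (-(A ^ 2 / (2 * (√((m + 1 : ℕ) : ℝ) - A)))) *
        (∫ G, weightFun A (normFluct (m + 1) G) ∂stdGaussian (𝔼 (m + 1))) *
        ∫ y, insideFun A ε (normFluct m y) ∂stdGaussian (𝔼 m)) ≤
      maxGaussianSurfaceArea (m + 1) / ENNReal.ofReal (((m + 1 : ℕ) : ℝ) ^ (1 / 4 : ℝ)) := by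
  have hs : Tendsto (fun m : ℕ => √((m + 1 : ℕ) : ℝ)) atTop atTop :=
    Real.tendsto_sqrt_atTop.comp (tendsto_natCast_atTop_atTop.comp (tendsto_add_atTop_nat 1))
  filter_upwards [eventually_insideFun_le hA hε, hs.eventually_gt_atTop A] with m hin hAs
  set s := √((m + 1 : ℕ) : ℝ) with hsdef
  replace hin := hin s hsdef
  have hs0 : 0 < s := hA.trans hAs
  have hroot : ((m + 1 : ℕ) : ℝ) ^ (1 / 4 : ℝ) = √s := by
    rw [hsdef, Real.sqrt_eq_rpow, Real.sqrt_eq_rpow, ← Real.rpow_mul (by positivity)]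
    norm_num
  set c := (√(2 * Real.pi))⁻¹ * Real.exp (-s / 2) * Real.exp (-(A ^ 2 / (2 * (s - A)))) with hc
  have hc0 : 0 ≤ c := by positivity
  set I := ∫ G, weightFun A (normFluct (m + 1) G) ∂stdGaussian (𝔼 (m + 1))
  set J := ∫ y, insideFun A ε (normFluct m y) ∂stdGaussian (𝔼 m)
  have hwm : Measurable fun G : 𝔼 (m + 1) => weightFun A (normFluct (m + 1) G) :=
    (continuous_weightFun A).measurable.comp (measurable_normFluct _)
  have him : Measurable fun y : 𝔼 m => insideFun A ε (normFluct m y) :=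
    (continuous_insideFun A ε).measurable.comp (measurable_normFluct _)
  have hIl : ∫⁻ G, ENNReal.ofReal (weightFun A (normFluct (m + 1) G)) ∂stdGaussian (𝔼 (m + 1))
      = ENNReal.ofReal I := by
    refine (ofReal_integral_eq_lintegral_ofReal ?_ (.of_forall fun _ => weightFun_nonneg _ _)).symm
    refine Integrable.of_bound hwm.aestronglyMeasurable (Real.exp (A / 2)) (.of_forall fun G => ?_)
    rw [Real.norm_of_nonneg (weightFun_nonneg _ _)]
    exact weightFun_le_exp hA _
  have hJl : ∫⁻ y, ENNReal.ofReal (insideFun A ε (normFluct m y)) ∂stdGaussian (𝔼 m)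
      = ENNReal.ofReal J := by
    refine (ofReal_integral_eq_lintegral_ofReal ?_ (.of_forall fun _ => insideFun_nonneg _ _ _)).symm
    refine Integrable.of_bound him.aestronglyMeasurable 1 (.of_forall fun G => ?_)
    rw [Real.norm_of_nonneg (insideFun_nonneg _ _ _)]
    exact insideFun_le_one hA hε.le _
  have hI0 : 0 ≤ I := integral_nonneg fun _ => weightFun_nonneg _ _
  have hJ0 : 0 ≤ J := integral_nonneg fun _ => insideFun_nonneg _ _ _
  -- There are `⌊facetCount s⌋₊ + 1` facets but only `⌊facetCount s⌋₊` competing constraints for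
  -- each, so both roundings go the right way.
  have hcount : facetCount s ≤ (⌊facetCount s⌋₊ : ℝ) + 1 := (Nat.lt_floor_add_one _).le
  rw [hroot, ENNReal.le_div_iff_mul_le (.inl (by simpa using hs0)) (.inl ENNReal.ofReal_ne_top),
    ← ENNReal.ofReal_mul (by positivity)]
  calc ENNReal.ofReal (Real.exp (-1 / 2) * Real.exp (-(A ^ 2 / (2 * (s - A)))) * I * J * √s)
      = ENNReal.ofReal (facetCount s * (c * I * J)) := by
        congr 1
        have : Real.exp ((s - 1) / 2) * Real.exp (-s / 2) = Real.exp (-1 / 2) := by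
          rw [← Real.exp_add]
          congr 1
          ring
        rw [← this, hc, facetCount]
        field_simp
    _ ≤ ENNReal.ofReal (((⌊facetCount s⌋₊ : ℝ) + 1) * (c * I * J)) :=
        ENNReal.ofReal_le_ofReal (mul_le_mul_of_nonneg_right hcount (by positivity))
    _ = ((⌊facetCount s⌋₊ : ℝ≥0∞) + 1) * (ENNReal.ofReal c * ENNReal.ofReal I * ENNReal.ofReal J) := by
        rw [ENNReal.ofReal_mul (by positivity), ENNReal.ofReal_mul (by positivity),
          ENNReal.ofReal_mul hc0, ENNReal.ofReal_add (by positivity) zero_le_one]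
        simp
    _ = (⌊facetCount s⌋₊ + 1) * ∫⁻ G, ENNReal.ofReal (c * weightFun A (normFluct (m + 1) G)) *
          ∫⁻ y, ENNReal.ofReal (insideFun A ε (normFluct m y)) ∂stdGaussian (𝔼 m)
          ∂stdGaussian (𝔼 (m + 1)) := by
        simp_rw [hJl, ENNReal.ofReal_mul hc0]
        rw [lintegral_mul_const _ (hwm.ennreal_ofReal.const_mul _),
          lintegral_const_mul _ hwm.ennreal_ofReal, hIl]
    _ ≤ (⌊facetCount s⌋₊ + 1) * ∫⁻ G, facetWeight (√(s ^ 3)) G * ∫⁻ y,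
          stdGaussian (𝔼 (m + 1)) {h | inner ℝ (facetPoint (√(s ^ 3)) G y) h < √(s ^ 3)} ^
            ⌊facetCount s⌋₊ ∂stdGaussian (𝔼 m) ∂stdGaussian (𝔼 (m + 1)) := by
        refine mul_le_mul_right (lintegral_mono fun G => ?_) _
        -- Where the cutoff vanishes so does the left side, so the estimates are needed only for
        -- fluctuations at most `A`.
        by_cases hcut : cutoff A (normFluct (m + 1) G) = 0
        · simp [weightFun, hcut]
        · exact mul_le_mul' (le_facetWeight hsdef hA hAs G)
            (lintegral_mono fun y => hin G (abs_le_of_cutoff_ne_zero hA hcut) y)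
    _ ≤ maxGaussianSurfaceArea (m + 1) :=
        lintegral_facet_le_maxGaussianSurfaceArea m _ (Real.sqrt_pos.2 (by positivity))

theorem le_liminf_maxGaussianSurfaceArea_div {A ε : ℝ} (hA : 0 < A) (hε : 0 < ε) :
    ENNReal.ofReal (Real.exp (-1 / 2) * (∫ x, weightFun A x ∂gaussianReal 0 2) *
        ∫ x, insideFun A ε x ∂gaussianReal 0 2) ≤
      liminf (fun n : ℕ => maxGaussianSurfaceArea n / ENNReal.ofReal ((n : ℝ) ^ (1 / 4 : ℝ)))
        atTop := by
  have hs : Tendsto (fun m : ℕ => √((m + 1 : ℕ) : ℝ)) atTop atTop :=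
    Real.tendsto_sqrt_atTop.comp (tendsto_natCast_atTop_atTop.comp (tendsto_add_atTop_nat 1))
  have hδ : Tendsto (fun m : ℕ => Real.exp (-(A ^ 2 / (2 * (√((m + 1 : ℕ) : ℝ) - A))))) atTop
      (𝓝 1) := by
    have h1 : Tendsto (fun m : ℕ => 2 * (√((m + 1 : ℕ) : ℝ) - A)) atTop atTop :=
      (tendsto_atTop_add_const_right _ (-A) hs).const_mul_atTop two_pos
    have h2 := (Real.continuous_exp.tendsto _).comp
      ((tendsto_const_nhds (x := A ^ 2)).div_atTop h1).neg
    simpa [Function.comp_def] using h2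
  have hlim := ENNReal.tendsto_ofReal (((hδ.const_mul (Real.exp (-1 / 2))).mul
    ((tendsto_integral_weightFun_normFluct hA).comp (tendsto_add_atTop_nat 1))).mul
    (tendsto_integral_insideFun_normFluct hA hε.le))
  rw [mul_one] at hlim
  rw [← liminf_nat_add _ 1]
  refine hlim.liminf_eq.symm.le.trans ?_
  exact liminf_le_liminf (eventually_le_maxGaussianSurfaceArea_div hA hε)

end GaussianSurface

theorem theorem2 :
    ENNReal.ofReal (Real.exp (-5 / 4)) ≤
      liminf (fun n : ℕ => GaussianSurface.maxGaussianSurfaceArea n /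
        ENNReal.ofReal ((n : ℝ) ^ (1 / 4 : ℝ))) atTop := by
  have hlim := ENNReal.tendsto_ofReal ((GaussianSurface.tendsto_integral_weightFun.const_mul
    (Real.exp (-1 / 2))).mul GaussianSurface.tendsto_integral_insideFun)
  -- The truncation is removed along `A = k + 1`, `ε = 1 / (k + 1)`, after the limit in the
  -- dimension.
  refine le_trans (ENNReal.ofReal_le_ofReal ?_) (le_of_tendsto' hlim fun k =>
    GaussianSurface.le_liminf_maxGaussianSurfaceArea_div (by positivity) (by positivity))
  calc Real.exp (-5 / 4) = Real.exp (-1 / 2) * Real.exp (1 / 4) * Real.exp (-1) := by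
        rw [← Real.exp_add, ← Real.exp_add]
        norm_num
    _ ≤ _ := mul_le_mul_of_nonneg_left
        (GaussianSurface.exp_neg_one_le_integral 2 (1 / 2)) (by positivity)
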